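/- All rings are commutative. For a ring $R$ and an $R$-module $M$ let $\operatorname{tr}_R(M)=\sum_{\varphi\in\operatorname{Hom}_R(M,R)}\varphi(M)$, and for a ring map $A\to B$ let $\Omega^m_{B/A}=\bigwedge^m_B\Omega^1_{B/A}$. A graded polynomial extension of a $\mathbb Z_{\ge 0}$-graded ring $T$ is a polynomial ring $T[x_1,\dots,x_n]$ ($n\ge 0$) with a grading that extends the one of $T$ and in which every $x_i$ is homogeneous of positive degree. For a $\mathbb Z_{\ge 0}$-graded ring $S$, $\operatorname{p.rk}(S)$ is the supremum of the $n\ge 0$ such that $S$ is isomorphic, as a graded ring, to a graded polynomial extension $T[x_1,\dots,x_n]$ of some graded subring $T$ of $S$, and $\operatorname{cop.rk}(S)$ is the infimum of the Krull dimensions of the graded rings $T$ such that $S$ is isomorphic, as a graded ring, to a graded polynomial extension of $T$. For a complete local $S_0$-algebra $S$, $\operatorname{fp.rk}(S)$ is the supremum of the $n\ge 0$ such that $S$ is isomorphic, as an $S_0$-algebra, to $T[[x_1,\dots,x_n]]$ for some $S_0$-subalgebra $T$ of $S$. **Theorem.** Let $S$ be a ring that contains $\mathbb Q$ and has finite Krull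 dimension $d$, and let $k$ be an integer with $0\le k\le d$. (1) Let $S=\bigoplus_{i\ge 0}S_i$ be $\mathbb Z_{\ge 0}$-graded. If $\operatorname{p.rk}(S)\ge d-k$, then $\operatorname{tr}_S(\Omega^{d-k}_{S/S_0})=S$. Conversely, if $S_0$ is a local ring and $\operatorname{tr}_S(\Omega^{d-k}_{S/S_0})=S$, then $\operatorname{cop.rk}(S)\le k$. (Neither ring is assumed to be Noetherian.) (2) Let $S_0$ be a Noetherian ring and let $S$ be a local $S_0$-algebra with maximal ideal $\mathfrak m_S$, essentially of finite type over $S_0$, whose residue field $S/\mathfrak m_S$ is algebraic over the image of $S_0$. Let $\widehat S$ be the $\mathfrak m_S$-adic completion of $S$, and let $\widehat\Omega^{m}_{\widehat S/S_0}=\varprojlim_n \Omega^{m}_{\widehat S/S_0}/\mathfrak m_S^n\Omega^{m}_{\widehat S/S_0}$. Then $\operatorname{fp.rk}(\widehat S)\ge d-k$ if and only if $\operatorname{tr}_{\widehat S}(\widehat\Omega^{d-k}_{\widehat S/S_0})=\widehat S$. -/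

import Mathlib

open scoped KaehlerDifferential

universe u v

noncomputable section

/-- The trace of a module: the sum of the images of all linear forms `M → R`. -/
def moduleTrace (R : Type u) [CommRing R] (M : Type v) [AddCommGroup M] [Module R M] : Ideal R :=
  ⨆ φ : M →ₗ[R] R, LinearMap.range φ

/-- The degree `i` part of the graded polynomial extension `T[x_1, …, x_n]` of the graded ring
`(T, 𝒯)` in which `x_l` is homogeneous of degree `w l`: it is additively generated by the terms
`t * x ^ m` with `t` in `𝒯 j` and `j + ∑ l, m l * w l = i`. -/
def polyExtPart {T : Type u} [CommRing T] (𝒯 : ℕ → AddSubgroup T) {n : ℕ} (w : Fin n → ℕ)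
    (i : ℕ) : AddSubgroup (MvPolynomial (Fin n) T) :=
  AddSubgroup.closure {p | ∃ (j : ℕ) (t : T) (m : Fin n →₀ ℕ),
    t ∈ 𝒯 j ∧ j + ∑ l, m l * w l = i ∧ p = MvPolynomial.monomial m t}

/-- `(S, 𝒜)` is isomorphic, as a graded ring, to a graded polynomial extension in `n` variables
of positive degrees of the graded ring `(T, 𝒯)`. -/
def IsGradedPolyExt {S : Type u} [CommRing S] (𝒜 : ℕ → AddSubgroup S)
    {T : Type v} [CommRing T] (𝒯 : ℕ → AddSubgroup T) (n : ℕ) : Prop :=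
  ∃ (w : Fin n → ℕ) (e : MvPolynomial (Fin n) T ≃+* S), (∀ l, 0 < w l) ∧
    ∀ (i : ℕ) (p : MvPolynomial (Fin n) T), p ∈ polyExtPart 𝒯 w i ↔ e p ∈ 𝒜 i

/-- The polynomial rank of a graded ring: the supremum of all `n` such that the ring is isomorphic
to a graded polynomial extension in `n` variables of one of its graded subrings. -/
def polyRank {S : Type u} [CommRing S] (𝒜 : ℕ → AddSubgroup S) [GradedRing 𝒜] : ℕ∞ :=
  sSup {N : ℕ∞ | ∃ (n : ℕ) (T : Subring S), N = n ∧
    (∀ t ∈ T, ∀ i, (DirectSum.decompose 𝒜 t i : S) ∈ T) ∧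
    IsGradedPolyExt 𝒜 (fun i => (𝒜 i).comap T.subtype.toAddMonoidHom) n}

/-- The copolynomial rank of a graded ring `S`: the infimum of the Krull dimensions of the graded
rings `T` such that `S` is isomorphic to a graded polynomial extension of `T`. (Such a `T` is
isomorphic to a subring of `S`, so it is no restriction to keep to the universe of `S`.) -/
def copolyRank {S : Type u} [CommRing S] (𝒜 : ℕ → AddSubgroup S) : WithBot ℕ∞ :=
  sInf {δ : WithBot ℕ∞ | ∃ (T : Type u) (_ : CommRing T) (𝒯 : ℕ → AddSubgroup T)
    (_ : GradedRing 𝒯) (n : ℕ), IsGradedPolyExt 𝒜 𝒯 n ∧ δ = ringKrullDim T}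

/-- The formal power series rank of an `S₀`-algebra (used for complete local algebras): the
supremum of all `n` such that the algebra is isomorphic to the ring of formal power series in `n`
variables over one of its `S₀`-subalgebras. -/
def powerSeriesRank (S₀ : Type u) [CommRing S₀] (S : Type v) [CommRing S] [Algebra S₀ S] : ℕ∞ :=
  sSup {N : ℕ∞ | ∃ (n : ℕ) (T : Subalgebra S₀ S), N = n ∧
    Nonempty (S ≃ₐ[S₀] MvPowerSeries (Fin n) T)}

/-- The completion of a local ring with respect to its maximal ideal. -/
abbrev LocalCompletion (S : Type v) [CommRing S] [IsLocalRing S] : Type v :=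
  AdicCompletion (IsLocalRing.maximalIdeal S) S

/-- The completed module of differentials of order `m` of the completion `Ŝ` of the local
`S₀`-algebra `S`: the completion of the `m`-th exterior power of the module of differentials of
`Ŝ` over `S₀` with respect to the ideal `𝔪_S Ŝ`. It is an `Ŝ`-module. -/
abbrev CompletedDifferentials (S₀ : Type u) [CommRing S₀] (S : Type v) [CommRing S]
    [IsLocalRing S] [Algebra S₀ S] (m : ℕ) : Type v :=
  AdicCompletion
    ((IsLocalRing.maximalIdeal S).map (algebraMap S (LocalCompletion S)))
    (⋀[LocalCompletion S]^m (Ω[LocalCompletion S⁄S₀]))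

end

/-!
A linear form `φ` on `⋀ᵐ Ω` and elements `a₁, …, aₘ` give the derivations
`Δ i x = φ (d a₁ ∧ ⋯ ∧ d x ∧ ⋯ ∧ d aₘ)` (`formDerivation`), with `Δ i (a j) = 0` for `i ≠ j` and
`Δ i (a i) = φ (d a₁ ∧ ⋯ ∧ d aₘ)`. If this last value is a unit, one obtains derivations that are
*dual* to the `a i`, that is, with `D i (a j) = δ i j` (`IsDualFamily`). Conversely, dual
derivations give the linear form `ω₁ ∧ ⋯ ∧ ωₘ ↦ det (D i (ωⱼ))`, which has the value one
on `d a₁ ∧ ⋯ ∧ d aₘ`. The partial derivatives of a polynomial or power series extension are dual to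
the variables, so that the trace of `⋀ᵐ Ω` is the whole ring for such an extension.

For the converse let `J` be the ideal generated by the `a i`. Over `ℚ`, `exp (-a i D i)` is a ring
endomorphism whenever it makes sense: in the complete case by convergence, in the graded
case because `D i` lowers degrees. It annihilates `a i`, fixes the other `a j` and is the identity
modulo `J`, so the composite `ρ` of these maps annihilates `J` and is the identity modulo `J`, although
the `D i` need not commute (`IsRetractionMod.exists_of_forall`). Hence the range `T` of `ρ` is
a complement of `J`. As the `a i` are quasi-regular, by differentiation of a relation of minimal degree
(`IsDualFamily.coeff_mem`), the map `X i ↦ a i` is an isomorphism from `T[X]` or `T[[X]]`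
(`IsDualFamily.exists_isGradedPolyExt`, `IsDualFamily.exists_mvPowerSeries_algEquiv`).

It remains to find `a i` in the right place. In the graded case with `𝒜 0` local they may be taken
homogeneous, of positive degree since `d` annihilates `𝒜 0`, and `D i` is the homogeneous component of
`Δ i` of degree `- deg (a i)`. In the local case the residue field is separable over the image of
`S₀`, so `a i` may be replaced by `f (a i)` in the maximal ideal, with `f` a polynomial over `S₀` such
that the derivative of `f` at `a i` is a unit.
-/

noncomputable section

/-! ### Dual families of derivations -/

/-- The derivations `D i` are dual to the elements `a j`: the matrix `(D i (a j))` is the identity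
matrix. -/
def IsDualFamily {R S ι : Type*} [CommRing R] [CommRing S] [Algebra R S] [DecidableEq ι]
    (D : ι → Derivation R S S) (a : ι → S) : Prop :=
  ∀ i j, D i (a j) = if i = j then 1 else 0

/-- Transport of a derivation along a ring isomorphism, as a derivation over any ring whose image
it annihilates. -/
def Derivation.transport {A B R S : Type*} [CommRing A] [CommRing B] [Algebra A B] [CommRing R]
    [CommRing S] [Algebra R S] (d : Derivation A B B) (e : B ≃+* S)
    (h : ∀ r : R, d (e.symm (algebraMap R S r)) = 0) : Derivation R S S :=
  Derivation.mk'
    { toFun := fun s => e (d (e.symm s))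
      map_add' := fun x y => by simp
      map_smul' := fun r x => by
        rw [Algebra.smul_def, map_mul, d.leibniz, h]
        simp [Algebra.smul_def] }
    fun x y => by simp

theorem Derivation.transport_apply {A B R S : Type*} [CommRing A] [CommRing B] [Algebra A B]
    [CommRing R] [CommRing S] [Algebra R S] (d : Derivation A B B) (e : B ≃+* S)
    (h : ∀ r : R, d (e.symm (algebraMap R S r)) = 0) (s : S) :
    d.transport e h s = e (d (e.symm s)) := rfl

theorem ENat.exists_le_of_le_sSup {m : ℕ} (hm : m ≠ 0) {s : Set ℕ∞} (h : (m : ℕ∞) ≤ sSup s) :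
    ∃ N ∈ s, (m : ℕ∞) ≤ N := by
  obtain ⟨k, rfl⟩ := Nat.exists_eq_succ_of_ne_zero hm
  obtain ⟨N, hN, hk⟩ := lt_sSup_iff.mp
    (lt_of_lt_of_le (by exact_mod_cast Nat.lt_succ_self k : (k : ℕ∞) < (k.succ : ℕ∞)) h)
  exact ⟨N, hN, by simpa using Order.add_one_le_of_lt hk⟩

theorem moduleTrace_eq_top_of_apply_eq_one {R : Type u} [CommRing R] {M : Type v} [AddCommGroup M]
    [Module R M] (φ : M →ₗ[R] R) (x : M) (h : φ x = 1) : moduleTrace R M = ⊤ := by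
  rw [Ideal.eq_top_iff_one, ← h]
  exact Submodule.mem_iSup_of_mem (p := fun ψ : M →ₗ[R] R => LinearMap.range ψ) φ ⟨x, rfl⟩

theorem exists_apply_notMem_of_moduleTrace_eq_top {R : Type u} [CommRing R] {M : Type v}
    [AddCommGroup M] [Module R M] (h : moduleTrace R M = ⊤) {I : Ideal R} (hI : I ≠ ⊤) :
    ∃ (φ : M →ₗ[R] R) (x : M), φ x ∉ I := by
  by_contra! H
  refine hI (top_le_iff.mp (h ▸ iSup_le fun φ => ?_))
  rintro _ ⟨x, rfl⟩
  exact H φ x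

section ExteriorForms

variable {R S : Type*} [CommRing R] [CommRing S] [Algebra R S] {m : ℕ}

/-- The linear form `ω₁ ∧ ⋯ ∧ ωₘ ↦ det (D i (ωⱼ))`. -/
theorem IsDualFamily.exists_exteriorPower_form {D : Fin m → Derivation R S S} {a : Fin m → S}
    (h : IsDualFamily D a) : ∃ φ : ⋀[S]^m (Ω[S⁄R]) →ₗ[S] S,
      φ (exteriorPower.ιMulti S m fun i => KaehlerDifferential.D R S (a i)) = 1 := by
  refine ⟨exteriorPower.alternatingMapLinearEquiv (Matrix.detRowAlternating.compLinearMap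
    (LinearMap.pi fun i => (D i).liftKaehlerDifferential)), ?_⟩
  rw [exteriorPower.alternatingMapLinearEquiv_apply_ιMulti]
  have hM : (Matrix.of fun i j : Fin m =>
      (D j).liftKaehlerDifferential (KaehlerDifferential.D R S (a i))) = 1 := by
    ext i j
    simp [h j i, Matrix.one_apply, eq_comm]
  exact (congrArg Matrix.det hM).trans Matrix.det_one

/-- A form with a value outside `I` has such a value at some `d a₁ ∧ ⋯ ∧ d aₘ`, where the `a i` may
be taken from any set whose differentials generate the module of differentials. -/
theorem exists_form_ιMulti_D_notMem (s : Set S)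
    (hs : Submodule.span S (KaehlerDifferential.D R S '' s) = ⊤) {I : Ideal S}
    (φ : ⋀[S]^m (Ω[S⁄R]) →ₗ[S] S) {ω : ⋀[S]^m (Ω[S⁄R])} (hω : φ ω ∉ I) :
    ∃ a : Fin m → S, (∀ i, a i ∈ s) ∧
      φ (exteriorPower.ιMulti S m fun i => KaehlerDifferential.D R S (a i)) ∉ I := by
  by_contra! H
  have key : (⊤ : Submodule S (⋀[S]^m (Ω[S⁄R]))) ≤ Submodule.comap φ I := by
    rw [← exteriorPower.ιMulti_span_of_span S m _ hs, Submodule.span_le]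
    rintro _ ⟨v, hv, rfl⟩
    choose a ha hav using fun i => hv ⟨i, rfl⟩
    have := H a ha
    simp only [hav] at this
    exact this
  exact hω (key trivial)

/-- The derivation obtained from a linear form on the `m`-th exterior power of the differentials by
letting the `i`-th factor of `d a₁ ∧ ⋯ ∧ d aₘ` vary. -/
def formDerivation (φ : ⋀[S]^m (Ω[S⁄R]) →ₗ[S] S) (a : Fin m → S) (i : Fin m) :
    Derivation R S S :=
  ((φ.compAlternatingMap (exteriorPower.ιMulti S m)).toMultilinearMap.toLinearMap
    (fun j => KaehlerDifferential.D R S (a j)) i).compDer (KaehlerDifferential.D R S)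

theorem formDerivation_apply_self (φ : ⋀[S]^m (Ω[S⁄R]) →ₗ[S] S) (a : Fin m → S) (i : Fin m) :
    formDerivation φ a i (a i) =
      φ (exteriorPower.ιMulti S m fun j => KaehlerDifferential.D R S (a j)) := by
  simp [formDerivation]

theorem formDerivation_apply_of_ne (φ : ⋀[S]^m (Ω[S⁄R]) →ₗ[S] S) (a : Fin m → S) {i j : Fin m}
    (hij : i ≠ j) : formDerivation φ a i (a j) = 0 := by
  have := (φ.compAlternatingMap (exteriorPower.ιMulti S m)).map_eq_zero_of_eq
    (Function.update (fun j => KaehlerDifferential.D R S (a j)) i (KaehlerDifferential.D R S (a j)))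
    (by simp [hij.symm]) hij
  simpa [formDerivation] using this

end ExteriorForms

/-! ### The Taylor homomorphism of a derivation -/

section Taylor

variable {R S : Type*} [CommRing R] [CommRing S] [Algebra R S] [Algebra ℚ S]

/-- The power series `exp (t D) f = ∑ (D ^ n f / n!) t ^ n`. -/
def taylorSeries (D : Derivation R S S) (f : S) : PowerSeries S :=
  PowerSeries.mk fun n => (n.factorial : ℚ)⁻¹ • (D^[n] f)

/-- The series `exp (t D) f` solves the differential equation `dF/dt = exp (t D) (D f)`. -/
theorem derivative_taylorSeries (D : Derivation R S S) (f : S) :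
    PowerSeries.derivative S (taylorSeries D f) = taylorSeries D (D f) := by
  ext n
  simp only [taylorSeries, PowerSeries.coeff_derivative, PowerSeries.coeff_mk,
    Function.iterate_succ_apply]
  have : ((n : S) + 1) = algebraMap ℚ S (n + 1) := by simp
  rw [this, mul_comm, ← Algebra.smul_def, smul_smul]
  congr 1
  rw [Nat.factorial_succ]
  push_cast
  field_simp

theorem taylorSeries_add (D : Derivation R S S) (f g : S) :
    taylorSeries D (f + g) = taylorSeries D f + taylorSeries D g := by
  ext n
  simp [taylorSeries, iterate_map_add]

theorem taylorSeries_mul (D : Derivation R S S) (f g : S) :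
    taylorSeries D (f * g) = taylorSeries D f * taylorSeries D g := by
  ext n
  induction n generalizing f g with
  | zero => simp [taylorSeries, PowerSeries.coeff_zero_eq_constantCoeff]
  | succ n ih =>
    -- both sides satisfy the same differential equation
    have key : PowerSeries.coeff n (PowerSeries.derivative S (taylorSeries D (f * g))) =
        PowerSeries.coeff n
          (PowerSeries.derivative S (taylorSeries D f * taylorSeries D g)) := by
      rw [derivative_taylorSeries, D.leibniz, (PowerSeries.derivative S).leibniz,
        derivative_taylorSeries, derivative_taylorSeries]
      simp only [smul_eq_mul, taylorSeries_add, map_add, ih]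
    rw [PowerSeries.coeff_derivative, PowerSeries.coeff_derivative] at key
    have hu : IsUnit ((n : S) + 1) := by
      have : ((n : S) + 1) = algebraMap ℚ S (n + 1) := by simp
      rw [this]
      exact (IsUnit.mk0 _ (by positivity)).map _
    exact hu.mul_right_cancel key

theorem taylorSeries_of_apply_eq_zero {D : Derivation R S S} {f : S} (h : D f = 0) :
    taylorSeries D f = PowerSeries.C f := by
  ext n
  cases n with
  | zero => simp [taylorSeries]
  | succ n =>
    simp [taylorSeries, Function.iterate_succ_apply, h, iterate_map_zero]

theorem taylorSeries_of_apply_eq_one {D : Derivation R S S} {f : S} (h : D f = 1) :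
    taylorSeries D f = PowerSeries.C f + PowerSeries.X := by
  ext n
  match n with
  | 0 => simp [taylorSeries]
  | 1 => simp [taylorSeries, h]
  | n + 2 =>
    simp [taylorSeries, PowerSeries.coeff_X, Function.iterate_succ_apply, h,
      iterate_map_zero]

/-- The Taylor homomorphism `f ↦ exp (t D) f` of a derivation `D`. -/
def taylorHom (D : Derivation R S S) : S →ₐ[R] PowerSeries S where
  toFun := taylorSeries D
  map_one' := by rw [taylorSeries_of_apply_eq_zero D.map_one_eq_zero, map_one]
  map_mul' := taylorSeries_mul D
  map_zero' := by rw [taylorSeries_of_apply_eq_zero (map_zero D), map_zero]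
  map_add' := taylorSeries_add D
  commutes' r := by
    rw [taylorSeries_of_apply_eq_zero (D.map_algebraMap r), PowerSeries.algebraMap_apply]

@[simp]
theorem taylorHom_apply (D : Derivation R S S) (f : S) : taylorHom D f = taylorSeries D f := rfl

end Taylor

/-! ### Quasi-regularity and retractions -/

section QuasiRegular

variable {R S ι : Type*} [CommRing R] [CommRing S] [Algebra R S] {a : ι → S}

theorem Derivation.apply_mem_pow_of_mem_pow_succ (D : Derivation R S S) {I : Ideal S} :
    ∀ {n : ℕ} {x : S}, x ∈ I ^ (n + 1) → D x ∈ I ^ n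
  | 0, _, _ => by simp
  | n + 1, x, hx => by
    rw [pow_succ] at hx
    induction hx using Submodule.mul_induction_on' with
    | mem_mul_mem y hy z hz =>
      rw [D.leibniz, smul_eq_mul, smul_eq_mul]
      refine add_mem (Ideal.mul_mem_right _ _ hy) ?_
      rw [pow_succ']
      exact Ideal.mul_mem_mul hz (D.apply_mem_pow_of_mem_pow_succ hy)
    | add y _ z _ hy hz => rw [map_add]; exact add_mem hy hz

theorem aeval_mem_span_pow {A : Type*} [CommRing A] [Algebra A S] {n : ℕ} {p : MvPolynomial ι A}
    (hp : p ∈ MvPolynomial.idealOfVars ι A ^ n) :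
    MvPolynomial.aeval a p ∈ Ideal.span (Set.range a) ^ n := by
  have h := Ideal.mem_map_of_mem (MvPolynomial.aeval (R := A) a) hp
  rw [Ideal.map_pow, Ideal.map_span, ← Set.range_comp] at h
  convert h using 4
  ext i
  simp

theorem MvPolynomial.IsHomogeneous.mem_pow_idealOfVars {A : Type*} [CommRing A] {n : ℕ}
    {p : MvPolynomial ι A} (hp : p.IsHomogeneous n) : p ∈ MvPolynomial.idealOfVars ι A ^ n := by
  rw [MvPolynomial.mem_pow_idealOfVars_iff']
  exact fun x hx => hp.coeff_eq_zero (by omega)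

/-- Chain rule for a derivation on a polynomial expression `p (a)`, up to the terms in which the
coefficients of `p` are differentiated. -/
theorem Derivation.apply_aeval_sub_mem [DecidableEq ι] (D : Derivation R S S) {i : ι}
    (hD : ∀ j, D (a j) = if i = j then 1 else 0)
    {n : ℕ} {p : MvPolynomial ι S} (hp : p.IsHomogeneous n) :
    D (MvPolynomial.aeval a p) - MvPolynomial.aeval a (MvPolynomial.pderiv i p) ∈
      Ideal.span (Set.range a) ^ n := by
  have hmon : ∀ m : ι →₀ ℕ, D (MvPolynomial.aeval a (MvPolynomial.monomial m (1 : S))) =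
      MvPolynomial.aeval a (MvPolynomial.pderiv i (MvPolynomial.monomial m (1 : S))) := by
    intro m
    induction m using Finsupp.induction_linear with
    | zero => simp
    | add f g hf hg =>
      have : MvPolynomial.monomial (f + g) (1 : S) =
        MvPolynomial.monomial f 1 * MvPolynomial.monomial g 1 := by simp
      rw [this, map_mul, D.leibniz, hf, hg, (MvPolynomial.pderiv i).leibniz, map_add,
        smul_eq_mul, smul_eq_mul, smul_eq_mul, smul_eq_mul, map_mul, map_mul]
    | single j k =>
      have : MvPolynomial.monomial (Finsupp.single j k) (1 : S) = MvPolynomial.X j ^ k := by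
        rw [MvPolynomial.X_pow_eq_monomial]
      rw [this, map_pow, MvPolynomial.aeval_X, D.leibniz_pow, (MvPolynomial.pderiv i).leibniz_pow,
        hD, MvPolynomial.pderiv_X]
      by_cases hij : i = j
      · subst hij; simp
      · simp [hij, Ne.symm hij]
  rw [p.as_sum]
  simp only [map_sum, ← Finset.sum_sub_distrib]
  refine sum_mem fun m hm => ?_
  have hc : MvPolynomial.monomial m (p.coeff m) =
      MvPolynomial.C (p.coeff m) * MvPolynomial.monomial m 1 := by
    rw [MvPolynomial.C_mul_monomial, mul_one]
  rw [hc, map_mul, D.leibniz, MvPolynomial.pderiv_C_mul, MvPolynomial.aeval_C]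
  simp only [Algebra.algebraMap_self, RingHom.id_apply, smul_eq_mul, map_mul, hmon,
    MvPolynomial.aeval_C, add_sub_cancel_left]
  refine Ideal.mul_mem_right _ _ (aeval_mem_span_pow ?_)
  refine MvPolynomial.IsHomogeneous.mem_pow_idealOfVars (MvPolynomial.isHomogeneous_monomial _ ?_)
  rw [← hp (MvPolynomial.mem_support_iff.mp hm), Finsupp.degree_eq_weight_one]
  rfl

/-- In a `ℚ`-algebra, a family with a dual family of derivations is quasi-regular. -/
theorem IsDualFamily.coeff_mem [DecidableEq ι] [Algebra ℚ S] {D : ι → Derivation R S S}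
    (h : IsDualFamily D a) {n : ℕ} {p : MvPolynomial ι S} (hp : p.IsHomogeneous n)
    (hpa : MvPolynomial.aeval a p ∈ Ideal.span (Set.range a) ^ (n + 1)) (m : ι →₀ ℕ) :
    p.coeff m ∈ Ideal.span (Set.range a) := by
  induction n generalizing p m with
  | zero =>
    have hpC := MvPolynomial.totalDegree_eq_zero_iff_eq_C.mp
      (Nat.le_zero.mp hp.totalDegree_le)
    rw [hpC, MvPolynomial.aeval_C, zero_add, pow_one] at hpa
    rw [hpC, MvPolynomial.coeff_C]
    split_ifs
    · exact hpa
    · exact zero_mem _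
  | succ n ih =>
    by_cases hm : m.degree = n + 1
    swap
    · rw [hp.coeff_eq_zero hm]; exact zero_mem _
    obtain ⟨i, hi⟩ : ∃ i, m i ≠ 0 := by
      by_contra! H
      have : m = 0 := Finsupp.ext H
      simp [this] at hm
    have h1 : MvPolynomial.aeval a (MvPolynomial.pderiv i p) ∈
        Ideal.span (Set.range a) ^ (n + 1) := by
      have h2 := (D i).apply_mem_pow_of_mem_pow_succ hpa
      have h3 := (D i).apply_aeval_sub_mem (h i) hp
      simpa using sub_mem h2 h3
    have h4 := ih (p := MvPolynomial.pderiv i p) hp.pderiv h1 (m - Finsupp.single i 1)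
    rw [MvPolynomial.coeff_pderiv, tsub_add_cancel_of_le (by
      rw [Finsupp.single_le_iff]; omega)] at h4
    refine (Ideal.mul_unit_mem_iff_mem _ ?_).mp h4
    have (k : ℕ) : (k : S) + 1 = algebraMap ℚ S (k + 1) := by simp
    rw [this]
    exact (IsUnit.mk0 _ (by positivity)).map _

/-- If the subring `T` meets the ideal generated by the `a i` in zero only, then a polynomial over
`T` whose value at `a` lies in the `n`-th power of that ideal has no terms of degree less than
`n`. -/
theorem IsDualFamily.mem_pow_idealOfVars [DecidableEq ι] [Algebra ℚ S]
    {D : ι → Derivation R S S} (h : IsDualFamily D a) {T : Subalgebra R S}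
    (hT : ∀ t ∈ T, t ∈ Ideal.span (Set.range a) → t = 0) {n : ℕ} {p : MvPolynomial ι T}
    (hp : MvPolynomial.aeval a p ∈ Ideal.span (Set.range a) ^ n) :
    p ∈ MvPolynomial.idealOfVars ι T ^ n := by
  induction n with
  | zero => simp
  | succ n ih =>
    have h1 := ih (Ideal.pow_le_pow_right n.le_succ hp)
    rw [MvPolynomial.mem_pow_idealOfVars_iff'] at h1
    set q := MvPolynomial.homogeneousComponent n p with hq
    have hqhom : q.IsHomogeneous n := MvPolynomial.homogeneousComponent_isHomogeneous n p
    have h2 : p - q ∈ MvPolynomial.idealOfVars ι T ^ (n + 1) := by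
      rw [MvPolynomial.mem_pow_idealOfVars_iff']
      intro x hx
      rw [MvPolynomial.coeff_sub, hq, MvPolynomial.coeff_homogeneousComponent]
      split_ifs with hxn
      · exact sub_self _
      · rw [h1 x (by omega), sub_zero]
    have h3 : MvPolynomial.aeval a q ∈ Ideal.span (Set.range a) ^ (n + 1) := by
      simpa using sub_mem hp (aeval_mem_span_pow (a := a) h2)
    have h4 : MvPolynomial.aeval a (MvPolynomial.map (algebraMap T S) q) =
        MvPolynomial.aeval a q := by
      rw [MvPolynomial.aeval_map_algebraMap]
    have h5 : q = 0 := by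
      ext x
      have := h.coeff_mem (hqhom.map (algebraMap T S)) (h4 ▸ h3) x
      rw [MvPolynomial.coeff_map] at this
      simpa using hT _ (q.coeff x).2 this
    simpa [h5] using h2

end QuasiRegular

section Retraction

variable {R S ι : Type*} [CommRing R] [CommRing S] [Algebra R S]

/-- The endomorphism `ρ` of `S` is a retraction modulo the ideal `J` generated by the `a i`: it
annihilates the `a i` and is congruent to the identity modulo `J`. Then `ρ` induces an isomorphism
of `S ⧸ J` with the range of `ρ`. -/
structure IsRetractionMod (ρ : S →ₐ[R] S) (a : ι → S) : Prop where
  apply_eq_zero (i : ι) : ρ (a i) = 0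
  apply_sub_mem (f : S) : ρ f - f ∈ Ideal.span (Set.range a)

namespace IsRetractionMod

variable {ρ : S →ₐ[R] S} {a : ι → S}

theorem apply_eq_zero_of_mem (h : IsRetractionMod ρ a) {f : S}
    (hf : f ∈ Ideal.span (Set.range a)) : ρ f = 0 := by
  have : Ideal.span (Set.range a) ≤ RingHom.ker ρ := by
    rw [Ideal.span_le]
    rintro _ ⟨i, rfl⟩
    exact h.apply_eq_zero i
  exact this hf

theorem apply_apply (h : IsRetractionMod ρ a) (f : S) : ρ (ρ f) = ρ f :=
  sub_eq_zero.mp (by rw [← map_sub, h.apply_eq_zero_of_mem (h.apply_sub_mem f)])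

theorem eq_zero_of_mem_range (h : IsRetractionMod ρ a) (t : S) (ht : t ∈ ρ.range)
    (hta : t ∈ Ideal.span (Set.range a)) : t = 0 := by
  obtain ⟨f, rfl⟩ := ht
  change ρ f ∈ _ at hta
  exact (h.apply_apply f).symm.trans (h.apply_eq_zero_of_mem hta)

/-- If for each `i` there is an endomorphism that annihilates `a i`, fixes the other `a j`, and is
congruent to the identity modulo the `a j`, then the composite of these endomorphisms is a
retraction. -/
theorem exists_of_forall [Fintype ι] (M : Submonoid (S →ₐ[R] S)) (a : ι → S)
    (H : ∀ i, ∃ ρ ∈ M, ρ (a i) = 0 ∧ (∀ j ≠ i, ρ (a j) = a j) ∧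
      ∀ f, ρ f - f ∈ Ideal.span (Set.range a)) :
    ∃ ρ ∈ M, IsRetractionMod ρ a := by
  classical
  suffices ∀ s : Finset ι, ∃ ρ ∈ M, (∀ i ∈ s, ρ (a i) = 0) ∧ (∀ i ∉ s, ρ (a i) = a i) ∧
      ∀ f, ρ f - f ∈ Ideal.span (Set.range a) by
    obtain ⟨ρ, hM, h1, -, h2⟩ := this Finset.univ
    exact ⟨ρ, hM, fun i => h1 i (Finset.mem_univ i), h2⟩
  intro s
  induction s using Finset.induction_on with
  | empty => exact ⟨1, M.one_mem, by simp, by simp, by simp⟩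
  | insert i s hi ih =>
    obtain ⟨ρ, hM, h0, h1, h2⟩ := ih
    obtain ⟨σ, hσM, hσ0, hσ1, hσ2⟩ := H i
    refine ⟨ρ * σ, M.mul_mem hM hσM, fun j hj => ?_, fun j hj => ?_, fun f => ?_⟩
    · rw [AlgHom.mul_apply]
      by_cases hji : j = i
      · rw [hji, hσ0, map_zero]
      · rw [hσ1 j hji, h0 j (Finset.mem_of_mem_insert_of_ne hj hji)]
    · rw [Finset.mem_insert, not_or] at hj
      rw [AlgHom.mul_apply, hσ1 j hj.1, h1 j hj.2]
    · rw [AlgHom.mul_apply]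
      simpa using add_mem (h2 (σ f)) (hσ2 f)

end IsRetractionMod

end Retraction

/-! ### Evaluation of power series in adically complete rings -/

section AdicEval

variable {σ A S : Type*} [CommRing A] [CommRing S] [Algebra A S]

theorem aeval_mem_pow {I : Ideal S} {a : σ → S} (ha : ∀ i, a i ∈ I) {n : ℕ}
    {p : MvPolynomial σ A} (hp : p ∈ MvPolynomial.idealOfVars σ A ^ n) :
    MvPolynomial.aeval a p ∈ I ^ n := by
  refine Ideal.pow_right_mono ?_ n (aeval_mem_span_pow hp)
  rw [Ideal.span_le]
  rintro _ ⟨i, rfl⟩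
  exact ha i

variable [Finite σ] (I : Ideal S) (a : σ → S) (ha : ∀ i, a i ∈ I)

/-- The evaluation of power series at elements `a i` of `I`, modulo `I ^ n`. -/
def adicEvalMod (n : ℕ) : MvPowerSeries σ A →ₐ[A] S ⧸ I ^ n :=
  (Ideal.Quotient.liftₐ (MvPolynomial.idealOfVars σ A ^ n)
    ((Ideal.Quotient.mkₐ A (I ^ n)).comp (MvPolynomial.aeval a))
    (fun _ hx => Ideal.Quotient.eq_zero_iff_mem.mpr (aeval_mem_pow ha hx))).comp
      ((MvPowerSeries.truncTotalAlgHom σ A n).restrictScalars A)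

theorem factorₐ_comp_adicEvalMod {m n : ℕ} (hle : m ≤ n) :
    (Ideal.Quotient.factorₐ A (Ideal.pow_le_pow_right hle)).comp
      (adicEvalMod (A := A) I a ha n) = adicEvalMod I a ha m := by
  ext F
  have := aeval_mem_pow (I := I) ha
    (MvPowerSeries.truncTotal_sub_truncTotal_mem_pow_idealOfVars hle le_rfl F)
  rw [map_sub] at this
  exact (Ideal.Quotient.eq (I := I ^ m)).mpr this

variable [IsAdicComplete I S]

/-- Evaluation of power series over `A` at elements `a i` of the ideal `I` of an `I`-adically
complete `A`-algebra. -/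
def adicEval : MvPowerSeries σ A →ₐ[A] S :=
  IsAdicComplete.liftAlgHom I (adicEvalMod I a ha) (factorₐ_comp_adicEvalMod I a ha)

theorem adicEval_sub_mem (F : MvPowerSeries σ A) (n : ℕ) :
    adicEval I a ha F - MvPolynomial.aeval a (F.truncTotal n) ∈ I ^ n :=
  Ideal.Quotient.eq.mp (IsAdicComplete.mk_liftAlgHom I _ (factorₐ_comp_adicEvalMod I a ha) n F)

theorem adicEval_coe (p : MvPolynomial σ A) :
    adicEval I a ha (p : MvPowerSeries σ A) = MvPolynomial.aeval a p := by
  rw [IsHausdorff.eq_iff_smodEq (I := I)]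
  intro n
  rw [SModEq.sub_mem, smul_eq_mul, Ideal.mul_top]
  have h : (p : MvPowerSeries σ A).truncTotal n - p ∈ MvPolynomial.idealOfVars σ A ^ n :=
    (MvPolynomial.mem_pow_idealOfVars_iff' ..).mpr fun x hx => by
      simp [MvPowerSeries.coeff_truncTotal _ hx]
  simpa using add_mem (adicEval_sub_mem I a ha (p : MvPowerSeries σ A) n) (aeval_mem_pow ha h)

@[simp]
theorem adicEval_X (i : σ) : adicEval I a ha (MvPowerSeries.X i : MvPowerSeries σ A) = a i := by
  rw [← MvPolynomial.coe_X, adicEval_coe, MvPolynomial.aeval_X]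

theorem map_adicEval_span_X :
    (Ideal.span (Set.range (MvPowerSeries.X : σ → MvPowerSeries σ A))).map
      (adicEval I a ha) = Ideal.span (Set.range a) := by
  rw [Ideal.map_span, ← Set.range_comp]
  congr 2
  ext i
  simp

/-- A power series without terms of degree less than `n` lies in the `n`-th power of the ideal
generated by the variables. -/
theorem MvPowerSeries.sub_truncTotal_mem_pow (F : MvPowerSeries σ A) (n : ℕ) :
    F - (F.truncTotal n : MvPowerSeries σ A) ∈
      Ideal.span (Set.range (MvPowerSeries.X : σ → MvPowerSeries σ A)) ^ n := by
  set e := MvPowerSeries.toAdicCompletionAlgEquiv σ A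
  have h1 : e (F - (F.truncTotal n : MvPowerSeries σ A)) ∈
      (MvPolynomial.idealOfVars σ A ^ n • ⊤ : Submodule (MvPolynomial σ A)
        (AdicCompletion (MvPolynomial.idealOfVars σ A) (MvPolynomial σ A))) := by
    rw [AdicCompletion.pow_smul_top_eq_ker_eval (MvPolynomial.idealOfVars_fg σ A)]
    rw [LinearMap.mem_ker, map_sub, map_sub, sub_eq_zero, toAdicCompletionAlgEquiv_apply,
      toAdicCompletionAlgEquiv_apply, toAdicCompletion_coe]
    rfl
  have h2 := Submodule.mem_map_of_mem (f := e.symm.toLinearEquiv.toLinearMap) h1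
  rw [Submodule.map_smul''] at h2
  have h3 : F - (F.truncTotal n : MvPowerSeries σ A) ∈
      (MvPolynomial.idealOfVars σ A ^ n • ⊤ : Submodule (MvPolynomial σ A)
        (MvPowerSeries σ A)) := by
    have h4 := Submodule.smul_mono le_rfl le_top h2
    exact (e.symm_apply_apply (F - (F.truncTotal n : MvPowerSeries σ A))) ▸ h4
  rw [Ideal.smul_top_eq_map, Submodule.restrictScalars_mem, Ideal.map_pow, Ideal.map_span,
    ← Set.range_comp] at h3
  have hX : algebraMap (MvPolynomial σ A) (MvPowerSeries σ A) ∘ MvPolynomial.X =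
      MvPowerSeries.X := by
    funext i
    exact MvPolynomial.coe_X i
  rwa [hX] at h3

/-- The error of a truncation lies in the powers of the ideal generated by the `a i` themselves,
which may be much smaller than those of `I`. -/
theorem adicEval_sub_mem_span (F : MvPowerSeries σ A) (n : ℕ) :
    adicEval I a ha F - MvPolynomial.aeval a (F.truncTotal n) ∈
      Ideal.span (Set.range a) ^ n := by
  have := Ideal.mem_map_of_mem (adicEval I a ha) (F.sub_truncTotal_mem_pow n)
  rwa [Ideal.map_pow, map_adicEval_span_X, map_sub, adicEval_coe] at this

end AdicEval

theorem IsHausdorff.of_ideal_le {S : Type*} [CommRing S] {I J : Ideal S} [IsHausdorff I S]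
    (h : J ≤ I) : IsHausdorff J S where
  haus' x hx := by
    refine IsHausdorff.haus (I := I) inferInstance x fun n => (hx n).mono ?_
    exact Submodule.smul_mono_left (Ideal.pow_right_mono h n)

/-! ### The structure of complete rings with dual families -/

section Complete

variable {R S ι : Type*} [CommRing R] [CommRing S] [Algebra R S] [Algebra ℚ S]
  (I : Ideal S) [IsAdicComplete I S]

/-- The endomorphism `exp (-a D)`, for a derivation `D` with `D a = 1` and `a` in `I`. -/
theorem exists_exp_neg_smul_derivation (D : Derivation R S S) {a : S} (ha : a ∈ I)
    (hDa : D a = 1) :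
    ∃ ρ : S →ₐ[R] S, ρ a = 0 ∧ (∀ b, D b = 0 → ρ b = b) ∧ ∀ f, ρ f - f ∈ Ideal.span {a} := by
  let ev : PowerSeries S →ₐ[S] S := adicEval I (fun _ : Unit => -a) (fun _ => neg_mem ha)
  have hX : ev PowerSeries.X = -a := adicEval_X I (fun _ : Unit => -a) _ ()
  have hC (c : S) : ev (PowerSeries.C c) = c := ev.commutes c
  refine ⟨(ev.restrictScalars R).comp (taylorHom D), ?_, fun b hb => ?_, fun f => ?_⟩
  · simp [taylorSeries_of_apply_eq_one hDa, hX, hC]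
  · simp [taylorSeries_of_apply_eq_zero hb, hC]
  · have h0 : PowerSeries.constantCoeff (taylorSeries D f) = f := by
      simp [taylorSeries]
    have h := PowerSeries.sub_const_eq_X_mul_shift (taylorSeries D f)
    have h' := congrArg ev h
    rw [h0, map_sub, map_mul, hX, hC] at h'
    simp only [AlgHom.comp_apply, taylorHom_apply, AlgHom.restrictScalars_apply, h']
    exact Ideal.mul_mem_right _ _ (neg_mem (Ideal.mem_span_singleton_self a))

/-- A complete `ℚ`-algebra with elements of `I` that have a dual family of
derivations is a ring of formal power series in these elements. -/
theorem IsDualFamily.exists_mvPowerSeries_algEquiv [Fintype ι] [DecidableEq ι]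
    {D : ι → Derivation R S S} {a : ι → S} (h : IsDualFamily D a) (ha : ∀ i, a i ∈ I) :
    ∃ T : Subalgebra R S, Nonempty (S ≃ₐ[R] MvPowerSeries ι T) := by
  obtain ⟨ρ, -, hρ⟩ := IsRetractionMod.exists_of_forall (R := R) ⊤ a fun i => by
    obtain ⟨ρ, h0, h1, h2⟩ := exists_exp_neg_smul_derivation I (D i) (ha i) (by simp [h i i])
    refine ⟨ρ, trivial, h0, fun j hj => h1 _ (by simp [h i j, hj.symm]), fun f => ?_⟩
    exact Ideal.span_mono (by simp) (h2 f)
  refine ⟨ρ.range, ⟨(AlgEquiv.ofBijective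
    ((adicEval I a ha : MvPowerSeries ι ρ.range →ₐ[ρ.range] S).restrictScalars R)
    ⟨?_, ?_⟩).symm⟩⟩
  · rw [injective_iff_map_eq_zero]
    intro F hF
    ext x
    have h1 := adicEval_sub_mem_span I a ha F (x.degree + 1)
    have h2 : adicEval I a ha F = 0 := hF
    rw [h2, zero_sub, neg_mem_iff] at h1
    have h3 := h.mem_pow_idealOfVars hρ.eq_zero_of_mem_range h1
    rw [MvPolynomial.mem_pow_idealOfVars_iff'] at h3
    have h4 := h3 x (Nat.lt_succ_self _)
    rw [MvPowerSeries.coeff_truncTotal _ (Nat.lt_succ_self _)] at h4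
    rw [h4, map_zero]
  · have hmap := map_adicEval_span_X (A := ρ.range) I a ha
    have hle : Ideal.span (Set.range a) ≤ I := by
      rw [Ideal.span_le]
      rintro _ ⟨i, rfl⟩
      exact ha i
    have : IsHausdorff ((Ideal.span (Set.range
        (MvPowerSeries.X : ι → MvPowerSeries ι ρ.range))).map
        (adicEval I a ha : MvPowerSeries ι ρ.range →ₐ[ρ.range] S).toRingHom) S :=
      IsHausdorff.of_ideal_le (I := I) (hmap.trans_le hle)
    refine surjective_of_mk_map_comp_surjective
      (adicEval I a ha : MvPowerSeries ι ρ.range →ₐ[ρ.range] S).toRingHom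
      (I := Ideal.span (Set.range MvPowerSeries.X)) fun y => ?_
    obtain ⟨f, rfl⟩ := Ideal.Quotient.mk_surjective y
    refine ⟨MvPowerSeries.C (⟨ρ f, f, rfl⟩ : ρ.range), ?_⟩
    rw [RingHom.comp_apply, Ideal.Quotient.eq]
    have hC : (adicEval I a ha : MvPowerSeries ι ρ.range →ₐ[ρ.range] S).toRingHom
        (MvPowerSeries.C (⟨ρ f, f, rfl⟩ : ρ.range)) = ρ f :=
      (adicEval I a ha : MvPowerSeries ι ρ.range →ₐ[ρ.range] S).commutes ⟨ρ f, f, rfl⟩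
    rw [hC]
    exact hmap.symm ▸ hρ.apply_sub_mem f

end Complete

/-! ### Homogeneous derivations of graded rings -/

section Graded

open DirectSum

variable {S : Type u} [CommRing S] (𝒜 : ℕ → AddSubgroup S)

/-- The derivation `D` of a graded ring is homogeneous of degree `-w`. -/
def LowersDegree {R : Type*} [CommRing R] [Algebra R S] (D : Derivation R S S) (w : ℕ) : Prop :=
  ∀ j, ∀ x ∈ 𝒜 j, (w ≤ j → D x ∈ 𝒜 (j - w)) ∧ (j < w → D x = 0)

variable {𝒜} in
theorem LowersDegree.iterate {R : Type*} [CommRing R] [Algebra R S] {D : Derivation R S S} {w : ℕ}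
    (h : LowersDegree 𝒜 D w) {j : ℕ} {x : S} (hx : x ∈ 𝒜 j) (n : ℕ) :
    (n * w ≤ j → D^[n] x ∈ 𝒜 (j - n * w)) ∧ (j < n * w → D^[n] x = 0) := by
  induction n with
  | zero => simpa using hx
  | succ n ih =>
    rw [Function.iterate_succ_apply', Nat.succ_mul]
    by_cases hn : n * w ≤ j
    · have h1 := h _ _ (ih.1 hn)
      refine ⟨fun hj => ?_, fun hj => h1.2 (by omega)⟩
      rw [← Nat.sub_sub]
      exact h1.1 (by omega)
    · rw [ih.2 (by omega), map_zero]
      exact ⟨fun _ => zero_mem _, fun _ => rfl⟩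

variable [GradedRing 𝒜]

/-- The homogeneous component of degree `-w` of a derivation. -/
theorem exists_homogeneous_component_derivation {R : Type*} [CommRing R] [Algebra R S]
    (Δ : Derivation R S S) (w : ℕ) :
    ∃ D : Derivation ℤ S S, ∀ j, ∀ x ∈ 𝒜 j,
      D x = if w ≤ j then (decompose 𝒜 (Δ x) (j - w) : S) else 0 := by
  let c (j : ℕ) : 𝒜 j →+ S :=
    if w ≤ j then (GradedRing.proj 𝒜 (j - w)).comp
      ((Δ : S →ₗ[R] S).toAddMonoidHom.comp (𝒜 j).subtype) else 0
  let f : S →+ S := (DirectSum.toAddMonoid c).comp (decomposeAddEquiv 𝒜).toAddMonoidHom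
  have hf : ∀ j, ∀ x ∈ 𝒜 j, f x = if w ≤ j then (decompose 𝒜 (Δ x) (j - w) : S) else 0 := by
    intro j x hx
    have : f x = c j ⟨x, hx⟩ := by
      simp [f, decompose_of_mem 𝒜 hx]
    rw [this]
    simp only [c]
    split_ifs <;> rfl
  refine ⟨Derivation.mk' f.toIntLinearMap fun x y => ?_, hf⟩
  change f (x * y) = x * f y + y * f x
  have key : ∀ j l, ∀ x ∈ 𝒜 j, ∀ z : S, w ≤ j + l → (decompose 𝒜 (x * z) (j + l - w) : S) =
      x * if w ≤ l then (decompose 𝒜 z (l - w) : S) else 0 := by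
    intro j l x hx z hw
    rw [coe_decompose_mul_of_left_mem 𝒜 _ hx]
    by_cases hl : w ≤ l
    · have hjl : j + l - w - j = l - w := by omega
      rw [if_pos (by omega), if_pos hl, hjl]
    · rw [if_neg (by omega), if_neg hl, mul_zero]
  induction x using DirectSum.Decomposition.inductionOn 𝒜 with
  | zero => simp
  | add x x' hx hx' => rw [add_mul, map_add, hx, hx', map_add]; ring
  | homogeneous x =>
    rename_i j
    induction y using DirectSum.Decomposition.inductionOn 𝒜 with
    | zero => simp
    | add y y' hy hy' => rw [mul_add, map_add, hy, hy', map_add]; ring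
    | homogeneous y =>
      rename_i l
      rw [hf (j + l) _ (SetLike.mul_mem_graded x.2 y.2), hf j _ x.2, hf l _ y.2]
      by_cases hw : w ≤ j + l
      · rw [if_pos hw, Δ.leibniz, decompose_add, smul_eq_mul, smul_eq_mul, DirectSum.add_apply,
          AddSubgroup.coe_add, key j l x x.2 _ hw, add_comm j l, key l j y y.2 _ (by omega)]
      · rw [if_neg hw, if_neg (by omega), if_neg (by omega)]
        simp

variable {𝒜} in
theorem smul_mem_graded_of_rat [Algebra ℚ S] (q : ℚ) {i : ℕ} {x : S} (hx : x ∈ 𝒜 i) :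
    q • x ∈ 𝒜 i := by
  have h : GradedRing.proj 𝒜 i (q • x) = q • GradedRing.proj 𝒜 i x := map_rat_smul _ q x
  rw [GradedRing.proj_apply, GradedRing.proj_apply, decompose_of_mem_same 𝒜 hx] at h
  exact h ▸ SetLike.coe_mem _

/-- The endomorphism `exp (-a D)`, for a homogeneous derivation `D` of negative degree `-w` and an
element `a` of degree `w` with `D a = 1`. -/
theorem exists_graded_exp_neg_smul_derivation [Algebra ℚ S] {D : Derivation ℤ S S} {w : ℕ}
    (hw : 0 < w) (hD : LowersDegree 𝒜 D w) {a : S} (ha : a ∈ 𝒜 w) (hDa : D a = 1) :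
    ∃ ρ : S →ₐ[ℤ] S, (∀ i, ∀ f ∈ 𝒜 i, ρ f ∈ 𝒜 i) ∧ ρ a = 0 ∧ (∀ b, D b = 0 → ρ b = b) ∧
      ∀ f, ρ f - f ∈ Ideal.span {a} := by
  let ι : Polynomial S →ₐ[ℤ] PowerSeries S :=
    (Polynomial.coeToPowerSeries.algHom (R := S) S).restrictScalars ℤ
  have hι (p : Polynomial S) : ι p = (p : PowerSeries S) := by
    simp [ι, Polynomial.coeToPowerSeries.algHom_apply]
  have hinj : Function.Injective ι := fun p q h => by
    rw [hι, hι] at h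
    exact Polynomial.coe_injective S h
  -- `D` is locally nilpotent, so the Taylor expansions of elements are polynomials
  have hrange (f : S) : taylorHom D f ∈ ι.range := by
    induction f using DirectSum.Decomposition.inductionOn 𝒜 with
    | zero => rw [map_zero]; exact zero_mem _
    | add f g hf hg => rw [map_add]; exact add_mem hf hg
    | homogeneous x =>
      rename_i j
      refine ⟨(taylorSeries D (x : S)).trunc (j + 1), ?_⟩
      change ι _ = _
      rw [hι]
      ext n
      rw [Polynomial.coeff_coe, PowerSeries.coeff_trunc]
      split_ifs with hn
      · rfl
      · have : j < n * w := lt_of_lt_of_le (by omega : j < n) (Nat.le_mul_of_pos_right n hw)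
        simp [taylorSeries, (hD.iterate x.2 n).2 this]
  let ρ : S →ₐ[ℤ] S := ((Polynomial.aeval (-a)).restrictScalars ℤ).comp
    ((AlgEquiv.ofInjective ι hinj).symm.toAlgHom.comp ((taylorHom D).codRestrict ι.range hrange))
  have hρ (f : S) (p : Polynomial S) (hp : (p : PowerSeries S) = taylorSeries D f) :
      ρ f = p.eval (-a) := by
    have : (AlgEquiv.ofInjective ι hinj).symm
        ((taylorHom D).codRestrict ι.range hrange f) = p := by
      rw [AlgEquiv.symm_apply_eq]
      apply Subtype.ext
      simp [hι, hp]
    change Polynomial.aeval (-a) ((AlgEquiv.ofInjective ι hinj).symm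
        ((taylorHom D).codRestrict ι.range hrange f)) = _
    rw [this, Polynomial.coe_aeval_eq_eval]
  have hex (f : S) : ∃ p : Polynomial S, (p : PowerSeries S) = taylorSeries D f := by
    obtain ⟨p, hp⟩ := hrange f
    exact ⟨p, (hι p).symm.trans hp⟩
  refine ⟨ρ, fun i f hf => ?_, ?_, fun b hb => ?_, fun f => ?_⟩
  · obtain ⟨p, hp⟩ := hex f
    rw [hρ f p hp, Polynomial.eval_eq_sum]
    refine sum_mem fun n _ => ?_
    have hc : p.coeff n = (n.factorial : ℚ)⁻¹ • D^[n] f := by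
      rw [← Polynomial.coeff_coe, hp]
      simp [taylorSeries]
    have hpow : (-a) ^ n ∈ 𝒜 (n * w) := SetLike.pow_mem_graded n (neg_mem ha)
    change p.coeff n * (-a) ^ n ∈ 𝒜 i
    rw [hc]
    by_cases hn : n * w ≤ i
    · have := SetLike.mul_mem_graded
        (smul_mem_graded_of_rat (n.factorial : ℚ)⁻¹ ((hD.iterate hf n).1 hn)) hpow
      rwa [Nat.sub_add_cancel hn] at this
    · rw [(hD.iterate hf n).2 (by omega), smul_zero, zero_mul]
      exact zero_mem _
  · rw [hρ a (Polynomial.C a + Polynomial.X)]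
    · simp
    · simp [taylorSeries_of_apply_eq_one hDa]
  · rw [hρ b (Polynomial.C b)]
    · simp
    · simp [taylorSeries_of_apply_eq_zero hb]
  · obtain ⟨p, hp⟩ := hex f
    have h0 : p.coeff 0 = f := by
      rw [← Polynomial.coeff_coe, hp]
      simp [taylorSeries]
    rw [hρ f p hp]
    have h := congrArg (Polynomial.eval (-a)) p.divX_mul_X_add
    rw [h0] at h
    simp only [Polynomial.eval_add, Polynomial.eval_mul, Polynomial.eval_X, Polynomial.eval_C] at h
    rw [← h, add_sub_cancel_right]
    exact Ideal.mul_mem_left _ _ (neg_mem (Ideal.mem_span_singleton_self a))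

/-! ### Graded retracts and graded polynomial extensions -/

/-- The grading of the range of an endomorphism of a graded ring. -/
abbrev rangeGrading (ρ : S →ₐ[ℤ] S) (i : ℕ) : AddSubgroup ρ.range :=
  (𝒜 i).comap ρ.range.val.toRingHom.toAddMonoidHom

/-- The range of an idempotent graded endomorphism is a graded ring. -/
@[reducible]
def rangeGradedRing (ρ : S →ₐ[ℤ] S) (hρ : ∀ i, ∀ f ∈ 𝒜 i, ρ f ∈ 𝒜 i)
    (hidem : ∀ f, ρ (ρ f) = ρ f) : GradedRing (rangeGrading 𝒜 ρ) :=
  let g (i : ℕ) : 𝒜 i →+ rangeGrading 𝒜 ρ i :=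
    { toFun := fun x => ⟨⟨ρ x, x, rfl⟩, hρ i x x.2⟩
      map_zero' := by ext; simp
      map_add' := fun x y => by ext; simp }
  have hfix (t : ρ.range) : ρ (t : S) = t := by
    obtain ⟨_, f, rfl⟩ := t
    exact hidem f
  { one_mem := SetLike.GradedOne.one_mem (A := 𝒜)
    mul_mem := fun _ _ _ _ hx hy => SetLike.mul_mem_graded (A := 𝒜) hx hy
    decompose' := fun t => DirectSum.map g (decompose 𝒜 (t : S))
    left_inv := fun t => by
      have key (y : ⨁ i, 𝒜 i) : ((DirectSum.coeAddMonoidHom (rangeGrading 𝒜 ρ)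
          (DirectSum.map g y) : ρ.range) : S) = ρ (DirectSum.coeAddMonoidHom 𝒜 y) := by
        induction y using DirectSum.induction_on with
        | zero => simp
        | of i x => simp [g]
        | add x y hx hy => simp [hx, hy]
      apply Subtype.ext
      rw [key]
      have : DirectSum.coeAddMonoidHom 𝒜 (decompose 𝒜 (t : S)) = t :=
        Decomposition.left_inv (ℳ := 𝒜) (t : S)
      rw [this, hfix]
    right_inv := fun y => by
      induction y using DirectSum.induction_on with
      | zero => simp
      | of i x =>
        have h1 : ((x : ρ.range) : S) ∈ 𝒜 i := x.2
        rw [DirectSum.coeAddMonoidHom_of]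
        change DirectSum.map g (decompose 𝒜 ((x : ρ.range) : S)) = _
        rw [decompose_of_mem 𝒜 h1, DirectSum.map_of]
        congr 1
        apply Subtype.ext
        apply Subtype.ext
        exact hfix x
      | add x y hx hy => simp [hx, hy] }

/-- A ring isomorphism from a polynomial ring over a graded ring that maps homogeneous elements of
degree `i` to homogeneous elements of degree `i` is an isomorphism of graded rings. -/
theorem mem_polyExtPart_iff {T : Type v} [CommRing T] (𝒯 : ℕ → AddSubgroup T) [GradedRing 𝒯]
    {n : ℕ} {w : Fin n → ℕ} (e : MvPolynomial (Fin n) T ≃+* S)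
    (he : ∀ i, ∀ p ∈ polyExtPart 𝒯 w i, e p ∈ 𝒜 i) (i : ℕ) (p : MvPolynomial (Fin n) T) :
    p ∈ polyExtPart 𝒯 w i ↔ e p ∈ 𝒜 i := by
  refine ⟨he i p, fun hp => ?_⟩
  have key (p : MvPolynomial (Fin n) T) : ∃ q : ℕ → MvPolynomial (Fin n) T,
      (∀ j, q j ∈ polyExtPart 𝒯 w j) ∧ ∀ j, (decompose 𝒜 (e p) j : S) = e (q j) := by
    have hadd {p p' : MvPolynomial (Fin n) T}
        (hp : ∃ q : ℕ → MvPolynomial (Fin n) T,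
          (∀ j, q j ∈ polyExtPart 𝒯 w j) ∧ ∀ j, (decompose 𝒜 (e p) j : S) = e (q j))
        (hp' : ∃ q : ℕ → MvPolynomial (Fin n) T,
          (∀ j, q j ∈ polyExtPart 𝒯 w j) ∧ ∀ j, (decompose 𝒜 (e p') j : S) = e (q j)) :
        ∃ q : ℕ → MvPolynomial (Fin n) T,
          (∀ j, q j ∈ polyExtPart 𝒯 w j) ∧ ∀ j, (decompose 𝒜 (e (p + p')) j : S) = e (q j) := by
      obtain ⟨q, h1, h2⟩ := hp
      obtain ⟨q', h1', h2'⟩ := hp'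
      exact ⟨q + q', fun j => add_mem (h1 j) (h1' j), fun j => by simp [h2, h2']⟩
    induction p using MvPolynomial.induction_on' with
    | add p q hp hq => exact hadd hp hq
    | monomial m t =>
      induction t using DirectSum.Decomposition.inductionOn 𝒯 with
      | zero => exact ⟨0, fun j => zero_mem _, fun j => by simp⟩
      | add t t' ht ht' => rw [map_add]; exact hadd ht ht'
      | homogeneous t =>
        rename_i j
        have hmem : MvPolynomial.monomial m (t : T) ∈ polyExtPart 𝒯 w (j + ∑ l, m l * w l) :=
          AddSubgroup.subset_closure ⟨j, t, m, t.2, rfl, rfl⟩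
        refine ⟨Pi.single (j + ∑ l, m l * w l) (MvPolynomial.monomial m (t : T)),
          fun l => ?_, fun l => ?_⟩
        · by_cases hl : l = j + ∑ l, m l * w l
          · subst hl; simpa using hmem
          · simp [hl]
        · by_cases hl : l = j + ∑ l, m l * w l
          · subst hl
            rw [decompose_of_mem_same 𝒜 (he _ _ hmem), Pi.single_eq_same]
          · rw [decompose_of_mem_ne 𝒜 (he _ _ hmem) (Ne.symm hl), Pi.single_eq_of_ne hl, map_zero]
  obtain ⟨q, h1, h2⟩ := key p
  have := h2 i
  rw [decompose_of_mem_same 𝒜 hp] at this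
  exact e.injective this ▸ h1 i

/-- A graded `ℚ`-algebra with homogeneous elements of positive degree that have a
dual family of homogeneous derivations is a graded polynomial extension in these elements. -/
theorem IsDualFamily.exists_isGradedPolyExt [Algebra ℚ S] {n : ℕ} {D : Fin n → Derivation ℤ S S}
    {a : Fin n → S} (h : IsDualFamily D a) {w : Fin n → ℕ} (hw : ∀ i, 0 < w i)
    (ha : ∀ i, a i ∈ 𝒜 (w i)) (hD : ∀ i, LowersDegree 𝒜 (D i) (w i)) :
    ∃ (T : Type u) (_ : CommRing T) (𝒯 : ℕ → AddSubgroup T) (_ : GradedRing 𝒯),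
      IsGradedPolyExt 𝒜 𝒯 n := by
  obtain ⟨ρ, hρdeg, hρ⟩ := IsRetractionMod.exists_of_forall (R := ℤ)
    { carrier := {ρ | ∀ i, ∀ f ∈ 𝒜 i, ρ f ∈ 𝒜 i}
      one_mem' := fun i f hf => hf
      mul_mem' := fun hρ hσ i f hf => hρ i _ (hσ i f hf) } a fun i => by
    obtain ⟨ρ, hdeg, h0, h1, h2⟩ :=
      exists_graded_exp_neg_smul_derivation 𝒜 (hw i) (hD i) (ha i) (by simp [h i i])
    refine ⟨ρ, hdeg, h0, fun j hj => h1 _ (by simp [h i j, hj.symm]), fun f => ?_⟩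
    exact Ideal.span_mono (by simp) (h2 f)
  have hinj : Function.Injective (MvPolynomial.aeval a : MvPolynomial (Fin n) ρ.range →ₐ[ρ.range] S)
      := by
    rw [injective_iff_map_eq_zero]
    intro p hp
    ext x : 1
    have h1 := h.mem_pow_idealOfVars hρ.eq_zero_of_mem_range (n := x.degree + 1) (p := p)
      (by rw [hp]; exact zero_mem _)
    rw [MvPolynomial.mem_pow_idealOfVars_iff'] at h1
    exact h1 x (Nat.lt_succ_self _)
  have hsurj :
      Function.Surjective (MvPolynomial.aeval a : MvPolynomial (Fin n) ρ.range →ₐ[ρ.range] S) := by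
    rw [← AlgHom.range_eq_top, eq_top_iff]
    suffices ∀ i, ∀ f ∈ 𝒜 i, f ∈
        (MvPolynomial.aeval a : MvPolynomial (Fin n) ρ.range →ₐ[ρ.range] S).range by
      intro f _
      induction f using DirectSum.Decomposition.inductionOn 𝒜 with
      | zero => exact zero_mem _
      | add f g hf hg => exact add_mem (hf trivial) (hg trivial)
      | homogeneous x => exact this _ _ x.2
    intro i
    induction i using Nat.strong_induction_on with
    | _ i ih =>
      intro f hf
      have h1 : f - ρ f ∈ Ideal.span (Set.range a) := by
        rw [← neg_mem_iff, neg_sub]; exact hρ.apply_sub_mem f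
      obtain ⟨c, hc⟩ := (Ideal.mem_span_range_iff_exists_fun).mp h1
      have h2 : f = ρ f + ∑ l, (decompose 𝒜 (c l * a l) i : S) := by
        have h3 := congrArg (GradedRing.proj 𝒜 i) hc
        rw [map_sum, GradedRing.proj_apply 𝒜 i (f - ρ f),
          decompose_of_mem_same 𝒜 (sub_mem hf (hρdeg i f hf))] at h3
        simp only [GradedRing.proj_apply] at h3
        rw [h3, add_sub_cancel]
      rw [h2]
      refine add_mem ?_ (sum_mem fun l _ => ?_)
      · exact ⟨MvPolynomial.C ⟨ρ f, f, rfl⟩, MvPolynomial.aeval_C _ _⟩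
      · rw [coe_decompose_mul_of_right_mem 𝒜 _ (ha l)]
        split_ifs with hl
        · have := hw l
          exact mul_mem (ih _ (by omega) _ (SetLike.coe_mem _))
            ⟨MvPolynomial.X l, MvPolynomial.aeval_X _ _⟩
        · exact zero_mem _
  refine ⟨ρ.range, inferInstance, rangeGrading 𝒜 ρ, rangeGradedRing 𝒜 ρ hρdeg hρ.apply_apply, w,
    RingEquiv.ofBijective (MvPolynomial.aeval a : MvPolynomial (Fin n) ρ.range →ₐ[ρ.range] S)
      ⟨hinj, hsurj⟩, hw, ?_⟩
  let _ := rangeGradedRing 𝒜 ρ hρdeg hρ.apply_apply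
  refine mem_polyExtPart_iff 𝒜 (rangeGrading 𝒜 ρ) _ fun i => ?_
  change polyExtPart _ w i ≤ (𝒜 i).comap (MvPolynomial.aeval a :
    MvPolynomial (Fin n) ρ.range →ₐ[ρ.range] S).toRingHom.toAddMonoidHom
  rw [polyExtPart, AddSubgroup.closure_le]
  rintro _ ⟨j, t, m, ht, rfl, rfl⟩
  change MvPolynomial.aeval a (MvPolynomial.monomial m t) ∈ 𝒜 (j + ∑ l, m l * w l)
  rw [MvPolynomial.aeval_monomial, Finsupp.prod_fintype _ _ (by simp)]
  refine SetLike.mul_mem_graded ht (SetLike.prod_mem_graded 𝒜 _ _ fun l _ => ?_)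
  exact SetLike.pow_mem_graded _ (ha l)

end Graded

/-! ### Differentials and polynomial ranks of graded rings -/

section GradedRank

open DirectSum

variable {S : Type u} [CommRing S] (𝒜 : ℕ → AddSubgroup S) [GradedRing 𝒜]

/-- In a graded polynomial extension the partial derivatives annihilate the elements of degree
zero, as these are constants. -/
theorem pderiv_eq_zero_of_mem_polyExtPart_zero {T : Type v} [CommRing T] {𝒯 : ℕ → AddSubgroup T}
    {n : ℕ} {w : Fin n → ℕ} (hw : ∀ l, 0 < w l) (i : Fin n) {p : MvPolynomial (Fin n) T}
    (hp : p ∈ polyExtPart 𝒯 w 0) : MvPolynomial.pderiv i p = 0 := by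
  suffices polyExtPart 𝒯 w 0 ≤
      (MvPolynomial.pderiv (R := T) i).toLinearMap.toAddMonoidHom.ker from this hp
  rw [polyExtPart, AddSubgroup.closure_le]
  rintro _ ⟨j, t, m, -, hm, rfl⟩
  change MvPolynomial.pderiv i (MvPolynomial.monomial m t) = 0
  have h1 : m i * w i = 0 := by
    have := Finset.single_le_sum (f := fun l => m l * w l) (fun _ _ => Nat.zero_le _)
      (Finset.mem_univ i)
    exact Nat.le_zero.mp (by omega)
  have h2 : m i = 0 := (Nat.mul_eq_zero.mp h1).resolve_right (hw i).ne'
  simp [MvPolynomial.pderiv_monomial, h2]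

theorem moduleTrace_eq_top_of_le_polyRank {m : ℕ} (h : (m : ℕ∞) ≤ polyRank 𝒜) :
    moduleTrace S (⋀[S]^m (Ω[S⁄𝒜 0])) = ⊤ := by
  suffices ∃ (D : Fin m → Derivation (𝒜 0) S S) (a : Fin m → S), IsDualFamily D a by
    obtain ⟨D, a, hDa⟩ := this
    obtain ⟨φ, hφ⟩ := hDa.exists_exteriorPower_form
    exact moduleTrace_eq_top_of_apply_eq_one φ _ hφ
  -- for `m = 0` the supremum gives no element of the set, but the empty family is dual
  rcases eq_or_ne m 0 with rfl | hm
  · exact ⟨0, 0, fun i => i.elim0⟩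
  obtain ⟨N, ⟨n, T, rfl, -, w, e, hw, he⟩, hN⟩ := ENat.exists_le_of_le_sSup hm h
  have hmn : m ≤ n := by exact_mod_cast hN
  refine ⟨fun i => (MvPolynomial.pderiv (R := T) (Fin.castLE hmn i)).transport e fun r => ?_,
    fun j => e (MvPolynomial.X (Fin.castLE hmn j)), fun i j => ?_⟩
  · refine pderiv_eq_zero_of_mem_polyExtPart_zero hw _ ((he 0 _).mpr ?_)
    rw [RingEquiv.apply_symm_apply]
    exact r.2
  · rw [Derivation.transport_apply, RingEquiv.symm_apply_apply, MvPolynomial.pderiv_X]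
    by_cases hij : i = j
    · simp [hij]
    · have : Fin.castLE hmn i ≠ Fin.castLE hmn j := fun H => hij (Fin.castLE_injective hmn H)
      simp [hij, this]

theorem span_D_homogeneous :
    Submodule.span S (KaehlerDifferential.D (𝒜 0) S '' {x | ∃ i, x ∈ 𝒜 i}) = ⊤ := by
  rw [← top_le_iff, ← KaehlerDifferential.span_range_derivation, Submodule.span_le]
  rintro _ ⟨x, rfl⟩
  induction x using DirectSum.Decomposition.inductionOn 𝒜 with
  | zero => rw [map_zero]; exact zero_mem _
  | add x y hx hy => rw [map_add]; exact add_mem hx hy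
  | homogeneous x => exact Submodule.subset_span ⟨x, ⟨_, x.2⟩, rfl⟩

theorem exists_isGradedPolyExt_of_moduleTrace_eq_top [Algebra ℚ S] [IsLocalRing (𝒜 0)] {m : ℕ}
    (h : moduleTrace S (⋀[S]^m (Ω[S⁄𝒜 0])) = ⊤) :
    ∃ (T : Type u) (_ : CommRing T) (𝒯 : ℕ → AddSubgroup T) (_ : GradedRing 𝒯),
      IsGradedPolyExt 𝒜 𝒯 m := by
  -- the ideal of the elements whose component of degree zero is not a unit of `𝒜 0`
  let I : Ideal S := (IsLocalRing.maximalIdeal (𝒜 0)).comap (GradedRing.projZeroRingHom' 𝒜)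
  have hI : I ≠ ⊤ := Ideal.comap_ne_top _ (Ideal.IsPrime.ne_top inferInstance)
  obtain ⟨φ, ω, hω⟩ := exists_apply_notMem_of_moduleTrace_eq_top h hI
  obtain ⟨a, ha, hφ⟩ := exists_form_ιMulti_D_notMem _ (span_D_homogeneous 𝒜) φ hω
  choose w hw using ha
  have hunit : IsUnit (GradedRing.projZeroRingHom' 𝒜
      (φ (exteriorPower.ιMulti S m fun i => KaehlerDifferential.D (𝒜 0) S (a i)))) := by
    by_contra H
    exact hφ ((IsLocalRing.mem_maximalIdeal _).mpr H)
  have hwpos (i : Fin m) : 0 < w i := by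
    by_contra H
    have hi : a i ∈ 𝒜 0 := by
      have := hw i
      rwa [Nat.eq_zero_of_not_pos H] at this
    have h0 : KaehlerDifferential.D (𝒜 0) S (a i) = 0 :=
      (KaehlerDifferential.D (𝒜 0) S).map_algebraMap ⟨a i, hi⟩
    rw [(exteriorPower.ιMulti S m).map_coord_zero i h0, map_zero, map_zero] at hunit
    exact not_isUnit_zero hunit
  obtain ⟨v, hv⟩ := hunit.exists_left_inv
  let ψ : ⋀[S]^m (Ω[S⁄𝒜 0]) →ₗ[S] S := (v : S) • φ
  have hψ : GradedRing.proj 𝒜 0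
      (ψ (exteriorPower.ιMulti S m fun i => KaehlerDifferential.D (𝒜 0) S (a i))) = 1 := by
    have h1 := congrArg (Subtype.val) hv
    rw [SetLike.GradeZero.coe_mul, GradedRing.coe_projZeroRingHom'_apply] at h1
    rw [GradedRing.proj_apply, LinearMap.smul_apply, smul_eq_mul,
      coe_decompose_mul_of_left_mem_zero 𝒜 v.2]
    exact h1
  choose D hD using fun i => exists_homogeneous_component_derivation 𝒜 (formDerivation ψ a i) (w i)
  refine IsDualFamily.exists_isGradedPolyExt 𝒜 (D := D) (a := a) (fun i j => ?_) hwpos hw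
    fun i j x hx => ?_
  · rw [hD i _ _ (hw j)]
    by_cases hij : i = j
    · subst hij
      rw [if_pos le_rfl, if_pos rfl, formDerivation_apply_self, Nat.sub_self]
      exact hψ
    · rw [formDerivation_apply_of_ne ψ a hij, if_neg hij]
      simp
  · rw [hD i _ _ hx]
    refine ⟨fun h => ?_, fun h => if_neg (by omega)⟩
    rw [if_pos h]
    exact SetLike.coe_mem _

/-- The ring `T` need not be Noetherian, but `dim T + n ≤ dim T[x₁, …, xₙ]` holds in general. -/
theorem copolyRank_le_of_moduleTrace_eq_top [Algebra ℚ S] [IsLocalRing (𝒜 0)] {d k : ℕ}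
    (hd : ringKrullDim S = d) (hk : k ≤ d)
    (h : moduleTrace S (⋀[S]^(d - k) (Ω[S⁄𝒜 0])) = ⊤) : copolyRank 𝒜 ≤ (k : WithBot ℕ∞) := by
  obtain ⟨T, _, 𝒯, _, hT⟩ := exists_isGradedPolyExt_of_moduleTrace_eq_top 𝒜 h
  have h0 : copolyRank 𝒜 ≤ ringKrullDim T :=
    sInf_le ⟨T, inferInstance, 𝒯, inferInstance, d - k, hT, rfl⟩
  refine h0.trans ?_
  obtain ⟨w, e, -, -⟩ := hT
  have h1 := ringKrullDim_add_natCard_le_ringKrullDim_mvPolynomial (R := T) (Fin (d - k))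
  rw [ringKrullDim_eq_of_ringEquiv e, hd, Nat.card_fin] at h1
  generalize ringKrullDim T = δ at h1
  induction δ with
  | bot => exact bot_le
  | coe δ =>
    change ((δ : ℕ∞) : WithBot ℕ∞) + (((d - k : ℕ) : ℕ∞) : WithBot ℕ∞) ≤
      ((d : ℕ∞) : WithBot ℕ∞) at h1
    change ((δ : ℕ∞) : WithBot ℕ∞) ≤ ((k : ℕ∞) : WithBot ℕ∞)
    rw [← WithBot.coe_add, WithBot.coe_le_coe] at h1
    rw [WithBot.coe_le_coe]
    induction δ with
    | top => simp at h1
    | coe δ =>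
      have : δ + (d - k) ≤ d := by exact_mod_cast h1
      exact_mod_cast (by omega : δ ≤ k)

end GradedRank

/-! ### Differentials and power series ranks of complete local rings -/

section Local

open IsLocalRing

/-- An element `x` of an extension of a domain `A` of characteristic zero that is algebraic over
`A` is a root of a polynomial over `A` whose derivative does not vanish at `x`. -/
theorem exists_aeval_eq_zero_and_aeval_derivative_ne_zero {A K : Type*} [CommRing A] [Field K]
    [CharZero K] [Algebra A K] [FaithfulSMul A K] {x : K} (hx : IsAlgebraic A x) :
    ∃ f : Polynomial A, Polynomial.aeval x f = 0 ∧ Polynomial.aeval x f.derivative ≠ 0 := by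
  obtain ⟨p, hp, hpx⟩ := hx
  induction hn : p.natDegree using Nat.strong_induction_on generalizing p with
  | _ n ih =>
    by_cases hd : Polynomial.aeval x p.derivative = 0
    swap
    · exact ⟨p, hpx, hd⟩
    have hinj := FaithfulSMul.algebraMap_injective A K
    have : CharZero A := (RingHom.charZero_iff hinj).mpr inferInstance
    have : IsDomain A := hinj.isDomain (algebraMap A K)
    have hp0 : p.natDegree ≠ 0 := by
      intro h0
      rw [Polynomial.eq_C_of_natDegree_eq_zero h0, Polynomial.aeval_C,
        map_eq_zero_iff _ hinj] at hpx
      rw [Polynomial.eq_C_of_natDegree_eq_zero h0, hpx, map_zero] at hp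
      exact hp rfl
    have hder : p.derivative ≠ 0 := by
      intro h0
      exact hp0 (Polynomial.derivative_eq_zero.mp h0)
    exact ih _ (hn ▸ Polynomial.natDegree_derivative_lt hp0) _ hder hd rfl

/-- A linear form on the completion of `M` is determined modulo `I` by its values on `M`. -/
theorem AdicCompletion.exists_apply_sub_apply_of_mem {R M : Type*} [CommRing R] [AddCommGroup M]
    [Module R M] {I : Ideal R} (hI : I.FG) (Φ : AdicCompletion I M →ₗ[R] R)
    (η : AdicCompletion I M) : ∃ x : M, Φ η - Φ (AdicCompletion.of I M x) ∈ I := by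
  obtain ⟨x, hx⟩ := Submodule.mkQ_surjective _ (AdicCompletion.eval I M 1 η)
  refine ⟨x, ?_⟩
  have h1 : η - AdicCompletion.of I M x ∈ (AdicCompletion.eval I M 1).ker := by
    rw [LinearMap.mem_ker, map_sub, AdicCompletion.eval_of, hx, sub_self]
  rw [← AdicCompletion.pow_smul_top_eq_ker_eval hI, pow_one] at h1
  have h2 := Submodule.mem_map_of_mem (f := Φ) h1
  rw [Submodule.map_smul'', map_sub] at h2
  have h3 := Submodule.smul_mono (le_refl I) (le_top : Submodule.map Φ ⊤ ≤ ⊤) h2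
  rwa [smul_eq_mul, Ideal.mul_top] at h3

variable {S₀ : Type u} {S : Type v} [CommRing S₀] [CommRing S] [IsLocalRing S] [Algebra S₀ S]

theorem moduleTrace_eq_top_of_le_powerSeriesRank [IsNoetherianRing S] {m : ℕ}
    (h : (m : ℕ∞) ≤ powerSeriesRank S₀ (LocalCompletion S)) :
    moduleTrace (LocalCompletion S) (CompletedDifferentials S₀ S m) = ⊤ := by
  set J := (maximalIdeal S).map (algebraMap S (LocalCompletion S)) with hJ
  have : IsAdicComplete J (LocalCompletion S) :=
    AdicCompletion.isAdicComplete_self _ (maximalIdeal S).fg_of_isNoetherianRing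
  suffices ∃ (D : Fin m → Derivation S₀ (LocalCompletion S) (LocalCompletion S))
      (a : Fin m → LocalCompletion S), IsDualFamily D a by
    obtain ⟨D, a, hDa⟩ := this
    obtain ⟨φ, hφ⟩ := hDa.exists_exteriorPower_form
    let Φ : CompletedDifferentials S₀ S m →ₗ[LocalCompletion S] LocalCompletion S :=
      (AdicCompletion.ofLinearEquiv J (LocalCompletion S)).symm.toLinearMap ∘ₗ
        (AdicCompletion.map J φ).restrictScalars (LocalCompletion S)
    refine moduleTrace_eq_top_of_apply_eq_one Φ (AdicCompletion.of J _
      (exteriorPower.ιMulti _ m fun i => KaehlerDifferential.D S₀ (LocalCompletion S) (a i))) ?_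
    change (AdicCompletion.ofLinearEquiv J (LocalCompletion S)).symm
      (AdicCompletion.map J φ (AdicCompletion.of J _ _)) = 1
    rw [AdicCompletion.map_of, hφ, AdicCompletion.ofLinearEquiv_symm_of]
  -- for `m = 0` the supremum gives no element of the set, but the empty family is dual
  rcases eq_or_ne m 0 with rfl | hm
  · exact ⟨0, 0, fun i => i.elim0⟩
  obtain ⟨N, ⟨n, T, rfl, ⟨e⟩⟩, hN⟩ := ENat.exists_le_of_le_sSup hm h
  have hmn : m ≤ n := by exact_mod_cast hN
  refine ⟨fun i => (MvPowerSeries.pderiv T (Fin.castLE hmn i)).transport e.symm.toRingEquiv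
    fun r => ?_, fun j => e.symm (MvPowerSeries.X (Fin.castLE hmn j)), fun i j => ?_⟩
  · have h1 : e.symm.toRingEquiv.symm (algebraMap S₀ (LocalCompletion S) r) =
        MvPowerSeries.C (algebraMap S₀ T r) :=
      (e.commutes r).trans MvPowerSeries.algebraMap_apply
    rw [h1, MvPowerSeries.pderiv_C]
  · have h1 : e.symm.toRingEquiv.symm (e.symm (MvPowerSeries.X (Fin.castLE hmn j))) =
        MvPowerSeries.X (Fin.castLE hmn j) := e.apply_symm_apply _
    rw [Derivation.transport_apply, h1, MvPowerSeries.pderiv_X]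
    by_cases hij : i = j
    · simp [hij]
    · have : Fin.castLE hmn i ≠ Fin.castLE hmn j := fun H => hij (Fin.castLE_injective hmn H)
      simp [hij, this]

/-- Each element `x` of the completion is, up to a unit factor of its differential, an element of
the maximal ideal: the residue field being separable over the image of `S₀`, there is a polynomial
`f` over `S₀` with `f x` in the maximal ideal and `f' x` a unit. -/
theorem exists_aeval_mem_and_isUnit_aeval_derivative [IsNoetherianRing S] [Algebra ℚ S]
    [Algebra.IsAlgebraic (algebraMap S₀ (ResidueField S)).range (ResidueField S)]
    (x : LocalCompletion S) :
    ∃ f : Polynomial S₀, Polynomial.aeval x f ∈ maximalIdeal (LocalCompletion S) ∧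
      IsUnit (Polynomial.aeval x f.derivative) := by
  let κ := ResidueField.map (algebraMap S (LocalCompletion S))
  have hκ : Function.Bijective κ := AdicCompletion.residueField_map_bijective S
  obtain ⟨c, hc⟩ := hκ.2 (residue _ x)
  have : CharZero (ResidueField S) := algebraRat.charZero _
  obtain ⟨g, hg, hg'⟩ := exists_aeval_eq_zero_and_aeval_derivative_ne_zero
    (Algebra.IsAlgebraic.isAlgebraic (R := (algebraMap S₀ (ResidueField S)).range) c)
  obtain ⟨f, rfl⟩ := Polynomial.map_surjective (algebraMap S₀ (ResidueField S)).rangeRestrict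
    (algebraMap S₀ (ResidueField S)).rangeRestrict_surjective g
  have key (p : Polynomial S₀) : residue _ (Polynomial.aeval x p) =
      κ (Polynomial.aeval c (p.map (algebraMap S₀ (ResidueField S)).rangeRestrict)) := by
    rw [Polynomial.aeval_def, Polynomial.aeval_def, Polynomial.eval₂_map, Polynomial.hom_eval₂,
      Polynomial.hom_eval₂, hc]
    rfl
  refine ⟨f, ?_, ?_⟩
  · rw [← residue_eq_zero_iff, key, hg, map_zero]
  · rw [← residue_ne_zero_iff_isUnit, key, ← Polynomial.derivative_map]
    exact (map_ne_zero κ).mpr hg'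

theorem le_powerSeriesRank_of_moduleTrace_eq_top [IsNoetherianRing S] [Algebra ℚ S]
    [Algebra.IsAlgebraic (algebraMap S₀ (ResidueField S)).range (ResidueField S)] {m : ℕ}
    (h : moduleTrace (LocalCompletion S) (CompletedDifferentials S₀ S m) = ⊤) :
    (m : ℕ∞) ≤ powerSeriesRank S₀ (LocalCompletion S) := by
  have hfg : ((maximalIdeal S).map (algebraMap S (LocalCompletion S))).FG :=
    (maximalIdeal S).fg_of_isNoetherianRing.map _
  have hJ : maximalIdeal (LocalCompletion S) =
    (maximalIdeal S).map (algebraMap S (LocalCompletion S)) := AdicCompletion.maximalIdeal_eq_map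
  obtain ⟨Φ, η, hη⟩ := exists_apply_notMem_of_moduleTrace_eq_top h
    (Ideal.IsPrime.ne_top (maximalIdeal.isMaximal (LocalCompletion S)).isPrime)
  let φ : ⋀[LocalCompletion S]^m (Ω[LocalCompletion S⁄S₀]) →ₗ[LocalCompletion S]
    LocalCompletion S := Φ ∘ₗ AdicCompletion.of _ _
  -- `η` may be replaced by a differential form that is congruent to it modulo the maximal ideal
  obtain ⟨ω, hω⟩ : ∃ ω, φ ω ∉ maximalIdeal (LocalCompletion S) := by
    obtain ⟨ω, hω⟩ := AdicCompletion.exists_apply_sub_apply_of_mem hfg Φ η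
    have h1 : Φ η - φ ω ∈ maximalIdeal (LocalCompletion S) := hJ.symm.le hω
    exact ⟨ω, fun H => hη (by simpa using add_mem h1 H)⟩
  obtain ⟨a, -, ha⟩ := exists_form_ιMulti_D_notMem Set.univ
    (by rw [Set.image_univ]; exact KaehlerDifferential.span_range_derivation _ _) φ hω
  choose f hf hf' using fun i => exists_aeval_mem_and_isUnit_aeval_derivative (S₀ := S₀) (a i)
  have hunit : IsUnit (φ (exteriorPower.ιMulti _ m fun i =>
      KaehlerDifferential.D S₀ (LocalCompletion S) (a i))) := by
    by_contra H
    exact ha ((mem_maximalIdeal _).mpr H)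
  choose v hv using fun i => ((hf' i).mul hunit).exists_left_inv
  have hdual : IsDualFamily (fun i => v i • formDerivation φ a i)
      (fun j => Polynomial.aeval (a j) (f j)) := by
    intro i j
    rw [Derivation.smul_apply, Derivation.map_aeval]
    by_cases hij : i = j
    · subst hij
      rw [formDerivation_apply_self, if_pos rfl, ← hv i, smul_eq_mul, smul_eq_mul]
    · rw [formDerivation_apply_of_ne φ a hij, if_neg hij, smul_zero, smul_zero]
  obtain ⟨T, hT⟩ := hdual.exists_mvPowerSeries_algEquiv
    (maximalIdeal (LocalCompletion S)) hf
  exact le_sSup ⟨m, T, rfl, hT⟩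

end Local

end

theorem theorem3p9 :
    -- the graded case, with `S₀ = 𝒜 0`
    (∀ (S : Type u) [CommRing S] [Algebra ℚ S] (𝒜 : ℕ → AddSubgroup S) [GradedRing 𝒜]
      (d k : ℕ), ringKrullDim S = d → k ≤ d →
        (((d - k : ℕ) : ℕ∞) ≤ polyRank 𝒜 →
          moduleTrace S (⋀[S]^(d - k) (Ω[S⁄𝒜 0])) = ⊤) ∧
        (IsLocalRing (𝒜 0) →
          moduleTrace S (⋀[S]^(d - k) (Ω[S⁄𝒜 0])) = ⊤ →
          copolyRank 𝒜 ≤ (k : WithBot ℕ∞))) ∧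
    -- the local case; the residue field of `S` is algebraic over the image of `S₀`
    (∀ (S₀ : Type u) (S : Type v) [CommRing S₀] [IsNoetherianRing S₀] [CommRing S]
      [IsLocalRing S] [Algebra ℚ S] [Algebra S₀ S] [Algebra.EssFiniteType S₀ S]
      [Algebra.IsAlgebraic (algebraMap S₀ (IsLocalRing.ResidueField S)).range
        (IsLocalRing.ResidueField S)]
      (d k : ℕ), ringKrullDim S = d → k ≤ d →
        (((d - k : ℕ) : ℕ∞) ≤ powerSeriesRank S₀ (LocalCompletion S) ↔
          moduleTrace (LocalCompletion S) (CompletedDifferentials S₀ S (d - k)) = ⊤)) := by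
  refine ⟨fun S _ _ 𝒜 _ d k hd hk => ⟨moduleTrace_eq_top_of_le_polyRank 𝒜,
    fun _ h => copolyRank_le_of_moduleTrace_eq_top 𝒜 hd hk h⟩, ?_⟩
  intro S₀ S _ _ _ _ _ _ _ _ d k _ _
  have := Algebra.EssFiniteType.isNoetherianRing S₀ S
  exact ⟨moduleTrace_eq_top_of_le_powerSeriesRank, le_powerSeriesRank_of_moduleTrace_eq_top⟩
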